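/- Let $\dot\sigma_b^2>0$ and consider sequences of positive integers $m=m_k\to\infty$ (number of clusters) and $n=n_k\to\infty$ (common cluster size) with $m/n^2\to 0$. For each $k$, observe the balanced Poisson random-intercept model with log link: the clusters $(\dot b_i,y_{i1},\dots,y_{in})$, $i=1,\dots,m$, are independent, $\dot b_i\sim N(0,\dot\sigma_b^2)$, and conditionally on $\dot b_i$ the responses $y_{i1},\dots,y_{in}$ are independent Poisson variables with mean $e^{\dot b_i}$, i.e. with density $f(y\mid \dot b_i)=\exp(y\dot b_i-e^{\dot b_i})/y!$. Let $\hat\sigma_b^2>0$ be a working variance, possibly random and depending on $k$, with $\hat\sigma_b^{-2}=O_p(1)$, and let $\hat b=(\hat b_1,\dots,\hat b_m)$ be the penalized quasi-likelihood estimator, i.e. the maximizer over $b\in\mathbb R^m$ of $$Q(b)=\sum_{i=1}^m\sum_{j=1}^n \ln f(y_{ij}\mid b_i)-\frac12\sum_{i=1}^m \hat\sigma_b^{-2}b_i^2 .$$ Then, unconditionally on the random effects, $$n^{1/2}(\hat b_1-\dot b_1)=n^{-1/2}\sum_{j=1}^n\{y_{1j}e^{-\dot b_1}-1\}+o_p(1).$$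 Moreover, the sum $S_k=n^{-1/2}\sum_{j=1}^n\{y_{1j}e^{-\dot b_1}-1\}$ is not asymptotically normal under any normalization: for no deterministic real sequences $(r_k)$, $(c_k)$ does $r_kS_k+c_k$ converge in distribution to a nondegenerate normal law. The same holds for the prediction gap $\hat b_1-\dot b_1$: for no deterministic real sequences $(r_k)$, $(c_k)$ does $r_k(\hat b_1-\dot b_1)+c_k$ converge in distribution to a nondegenerate normal law. -/

import Mathlib

open MeasureTheory ProbabilityTheory Filter Topology
open scoped ENNReal NNReal

noncomputable section

/-- The Poisson probability mass function on the canonical (log) scale: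
`f(y | η) = exp (y η - exp η) / y!`, i.e. mean `exp η`. -/
def poissonLogLinkDensity (η : ℝ) (y : ℕ) : ℝ :=
  Real.exp ((y : ℝ) * η - Real.exp η) / (y.factorial : ℝ)

/-- The balanced Poisson random-intercept model with log link, `m` clusters of size `n` and
random-effect variance `v`, on the probability space `(Ω, P)`:
the clusters `(b i, y i ·)` are independent, `b i ∼ N(0, v)`, and, conditionally on `b i`,
the responses `y i 1, …, y i n` are independent Poisson variables with mean `exp (b i)`. -/
structure PoissonRandomIntercept {Ω : Type*} [MeasurableSpace Ω] (P : Measure Ω)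
    (m n : ℕ) (v : ℝ≥0) (b : Fin m → Ω → ℝ) (y : Fin m → Fin n → Ω → ℕ) : Prop where
  measurable_effect : ∀ i, Measurable (b i)
  measurable_response : ∀ i j, Measurable (y i j)
  law_effect : ∀ i, HasLaw (b i) (gaussianReal 0 v) P
  /-- Given `b i`, the vector `(y i 1, …, y i n)` has the product Poisson density. -/
  cond_law_response : ∀ (i : Fin m) (A : Set ℝ) (l : Fin n → ℕ), MeasurableSet A →
    P (b i ⁻¹' A ∩ {ω | ∀ j, y i j ω = l j}) =
      ∫⁻ ω in b i ⁻¹' A, ∏ j, ENNReal.ofReal (poissonLogLinkDensity (b i ω) (l j)) ∂P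
  indep_clusters : iIndepFun (fun (i : Fin m) (ω : Ω) => (b i ω, fun j : Fin n => y i j ω)) P

/-- The penalized quasi-likelihood objective of this model, for data `y` and working
random-effect variance `s`:
`Q(β) = ∑ i, ∑ j, log f(y i j | β i) - (1/2) ∑ i, β i * s⁻¹ * β i`. -/
def pqlObjective {m n : ℕ} (y : Fin m → Fin n → ℕ) (s : ℝ) (β : Fin m → ℝ) : ℝ :=
  (∑ i, ∑ j, Real.log (poissonLogLinkDensity (β i) (y i j)))
    - (1 / 2) * ∑ i, β i * s⁻¹ * β i

/-- `β` is a PQL estimate: it maximizes the PQL objective over all vectors of random effects. -/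
def IsPQLEstimate {m n : ℕ} (y : Fin m → Fin n → ℕ) (s : ℝ) (β : Fin m → ℝ) : Prop :=
  IsMaxOn (pqlObjective y s) Set.univ β

/-- `X k = o_p(1)` as `k → ∞`. -/
def IsLittleOpOne {Ω : ℕ → Type*} [∀ k, MeasurableSpace (Ω k)] (P : ∀ k, Measure (Ω k))
    (X : ∀ k, Ω k → ℝ) : Prop :=
  ∀ ε : ℝ, 0 < ε → Tendsto (fun k => P k {ω | ε ≤ |X k ω|}) atTop (𝓝 0)

/-- `X k = O_p(1)` as `k → ∞` (stochastic boundedness). -/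
def IsBigOpOne {Ω : ℕ → Type*} [∀ k, MeasurableSpace (Ω k)] (P : ∀ k, Measure (Ω k))
    (X : ∀ k, Ω k → ℝ) : Prop :=
  ∀ ε : ℝ≥0∞, 0 < ε → ∃ C : ℝ, ∀ᶠ k in atTop, P k {ω | C < |X k ω|} ≤ ε

/-- `X k` is asymptotically normal under some deterministic normalization: there are real
sequences `r` (scale) and `c` (centering) such that `r k * X k + c k` converges in distribution
to a nondegenerate normal law. -/
def IsAsymptoticallyNormal {Ω : ℕ → Type*} [∀ k, MeasurableSpace (Ω k)]
    (P : ∀ k, Measure (Ω k)) [∀ k, IsProbabilityMeasure (P k)] (X : ∀ k, Ω k → ℝ) : Prop :=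
  ∃ (r c : ℕ → ℝ) (μ : ℝ) (w : ℝ≥0), w ≠ 0 ∧
    TendstoInDistribution (fun k ω => r k * X k ω + c k) atTop (id : ℝ → ℝ) P (gaussianReal μ w)

end

/-! The objective separates over clusters, so each coordinate of the estimate solves its own score
equation (`IsPQLEstimate.score_eq_zero`). Writing Δ for the gap, B for the true effect and τ for the
inverse working variance, the equation is n e^B (e^Δ - 1) + τ(B + Δ) = √n e^B S. When |B|, |S| and τ
are bounded by C, monotonicity forces Δ = O(n^{-1/2}), and expanding the exponential gives √n Δ - S
= O(n^{-1/2}) (`abs_sqrt_mul_sub_le`). All three quantities are O_p(1), which yields the expansion.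

Given b₁ = x, S is nearly N(0, e^{-x}). Averaging over x, its characteristic function tends to that
of a normal variance mixture (`tendsto_charFun_standardizedSum`). The mixture has variances
arbitrarily close to 0, so its transform decays more slowly than any Gaussian one
(`exists_lognormalMixtureCharFun_ne`). Comparing moduli of characteristic functions then excludes
every affine normalization (`not_isAsymptoticallyNormal_of_tendsto_charFun`). By the expansion, √n
times the gap has the same limit as S. -/

/-! ### Joint law of a cluster and transform of its standardized sum -/

/-- The conditional law of the responses of a cluster of size `n` given its random effect:
independent Poisson variables with mean `exp x`. -/
noncomputable def poissonResponseKernel (n : ℕ) : Kernel ℝ (Fin n → ℕ) where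
  toFun x := Measure.pi fun _ => poissonMeasure (Real.exp x).toNNReal
  measurable' := by
    refine Measure.measurable_of_measurable_coe _ fun s hs => ?_
    have h (x : ℝ) : (Measure.pi fun _ : Fin n => poissonMeasure (Real.exp x).toNNReal) s =
        ∑' l, s.indicator (fun l => ∏ j, ENNReal.ofReal
          (Real.exp (-Real.exp x) * Real.exp x ^ l j / (l j).factorial)) l := by
      rw [← Measure.tsum_indicator_apply_singleton _ _ hs]
      refine tsum_congr fun l => congrArg (fun g => s.indicator g l) (funext fun l => ?_)
      rw [Measure.pi_singleton]
      simp [poissonMeasure_singleton, Real.exp_nonneg]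
    simp_rw [h]
    refine Measurable.tsum fun l => ?_
    by_cases hl : l ∈ s
    · simp only [hl, Set.indicator_of_mem]
      fun_prop
    · simp [hl]

lemma poissonResponseKernel_apply (n : ℕ) (x : ℝ) :
    poissonResponseKernel n x =
      Measure.pi fun _ => poissonMeasure (Real.exp x).toNNReal := rfl

instance (n : ℕ) : IsMarkovKernel (poissonResponseKernel n) :=
  ⟨fun x => by rw [poissonResponseKernel_apply]; infer_instance⟩

lemma poissonResponseKernel_singleton (n : ℕ) (x : ℝ) (l : Fin n → ℕ) :
    poissonResponseKernel n x {l} = ∏ j, ENNReal.ofReal (poissonLogLinkDensity x (l j)) := by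
  rw [poissonResponseKernel_apply, Measure.pi_singleton]
  refine Finset.prod_congr rfl fun j _ => ?_
  rw [poissonMeasure_singleton, Real.coe_toNNReal _ (Real.exp_nonneg x), poissonLogLinkDensity,
    Real.exp_sub, Real.exp_neg, Real.exp_nat_mul]
  congr 2
  field_simp

/-- The joint law of the random effect and the responses of a cluster. -/
lemma PoissonRandomIntercept.map_cluster {Ω : Type*} [MeasurableSpace Ω] {P : Measure Ω}
    [IsProbabilityMeasure P] {m n : ℕ} {v : ℝ≥0} {b : Fin m → Ω → ℝ}
    {y : Fin m → Fin n → Ω → ℕ} (h : PoissonRandomIntercept P m n v b y) (i : Fin m) :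
    P.map (fun ω => (b i ω, fun j => y i j ω)) =
      gaussianReal 0 v ⊗ₘ poissonResponseKernel n := by
  have hb := h.measurable_effect i
  have hy : Measurable fun ω j => y i j ω := measurable_pi_lambda _ (h.measurable_response i)
  have hprob := Measure.isProbabilityMeasure_map (μ := P) (hb.prodMk hy).aemeasurable
  refine Measure.ext_prod_iff.2 fun {A D} hA hD => ?_
  have hsing (l : Fin n → ℕ) : P (b i ⁻¹' A ∩ {ω | ∀ j, y i j ω = l j}) =
      ∫⁻ x in A, poissonResponseKernel n x {l} ∂gaussianReal 0 v := by
    rw [h.cond_law_response i A l hA, ← (h.law_effect i).map_eq,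
      setLIntegral_map hA (Kernel.measurable_coe _ (measurableSet_singleton l)) hb]
    simp_rw [poissonResponseKernel_singleton]
  rw [Measure.map_apply (hb.prodMk hy) (hA.prod hD), Measure.compProd_apply_prod hA hD]
  -- The response space is countable, so a rectangle splits into countably many slices on which the
  -- model prescribes the probability.
  have h1 : (fun ω => (b i ω, fun j => y i j ω)) ⁻¹' A ×ˢ D =
      ⋃ l ∈ D, (b i ⁻¹' A ∩ {ω | ∀ j, y i j ω = l j}) := by
    ext ω
    simp only [Set.mem_preimage, Set.mem_prod, Set.mem_iUnion, Set.mem_inter_iff,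
      Set.mem_ofPred_eq, ← funext_iff, exists_prop]
    exact ⟨fun ⟨h1, h2⟩ => ⟨_, h2, h1, rfl⟩, fun ⟨l, h2, h1, h3⟩ => ⟨h1, h3 ▸ h2⟩⟩
  have hmeas (l : Fin n → ℕ) :
      MeasurableSet (b i ⁻¹' A ∩ {ω | ∀ j, y i j ω = l j}) := by
    refine (hb hA).inter ?_
    simp_rw [← funext_iff]
    exact hy (measurableSet_singleton l)
  rw [h1, measure_biUnion (Set.to_countable D) ?_ fun l _ => hmeas l]
  · simp_rw [hsing]
    rw [← lintegral_tsum fun l => (Kernel.measurable_coe _ (measurableSet_singleton _)).aemeasurable]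
    refine lintegral_congr fun x => ?_
    have := measure_biUnion (μ := poissonResponseKernel n x) (Set.to_countable D)
      (f := fun l => {l}) (fun l _ l' _ hll => by simpa [Function.onFun] using hll)
      fun l _ => measurableSet_singleton l
    rw [← this, Set.biUnion_of_singleton]
  · intro l _ l' _ hll
    rw [Function.onFun, Set.disjoint_left]
    rintro ω ⟨_, h1⟩ ⟨_, h2⟩
    exact hll (funext fun j => (h1 j).symm.trans (h2 j))

/-- The characteristic function of the standardized Poisson sum, averaged over the random effect. -/
lemma PoissonRandomIntercept.charFun_map_sum {Ω : Type*} [MeasurableSpace Ω] {P : Measure Ω}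
    [IsProbabilityMeasure P] {m n : ℕ} {v : ℝ≥0} {b : Fin m → Ω → ℝ}
    {y : Fin m → Fin n → Ω → ℕ} (h : PoissonRandomIntercept P m n v b y) (i : Fin m) (a u : ℝ) :
    charFun (P.map fun ω => a * ∑ j, ((y i j ω : ℝ) * Real.exp (-(b i ω)) - 1)) u =
      ∫ x, Complex.exp (n * Real.exp x * (Complex.exp ((u * a * Real.exp (-x) : ℝ) * Complex.I) - 1
        - (u * a * Real.exp (-x) : ℝ) * Complex.I)) ∂gaussianReal 0 v := by
  have hb := h.measurable_effect i
  have hy : Measurable fun ω j => y i j ω := measurable_pi_lambda _ (h.measurable_response i)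
  let g : ℝ × (Fin n → ℕ) → ℝ := fun p => a * ∑ j, ((p.2 j : ℝ) * Real.exp (-p.1) - 1)
  have hg : Measurable g := by fun_prop
  have hcomp : (fun ω => a * ∑ j, ((y i j ω : ℝ) * Real.exp (-(b i ω)) - 1)) =
      g ∘ fun ω => (b i ω, fun j => y i j ω) := rfl
  rw [hcomp, ← Measure.map_map hg (hb.prodMk hy), h.map_cluster i, charFun_apply_real,
    integral_map hg.aemeasurable (by fun_prop)]
  have hint : Integrable (fun p => Complex.exp (u * (g p : ℝ) * Complex.I))
      (gaussianReal 0 v ⊗ₘ poissonResponseKernel n) := by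
    refine (integrable_const (1 : ℝ)).mono' (by fun_prop) (.of_forall fun p => ?_)
    rw [← Complex.ofReal_mul, Complex.norm_exp_ofReal_mul_I]
  rw [Measure.integral_compProd hint]
  refine integral_congr_ae (.of_forall fun x => ?_)
  dsimp only
  rw [poissonResponseKernel_apply]
  have hfac (l : Fin n → ℕ) : Complex.exp (u * (g (x, l) : ℝ) * Complex.I) =
      ∏ j, (fun k : ℕ => Complex.exp (-(u * a * Complex.I)) *
        Complex.exp ((u * a * Real.exp (-x) : ℝ) * (k : ℝ) * Complex.I)) (l j) := by
    simp only [← Complex.exp_add, ← Complex.exp_sum, g]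
    congr 1
    push_cast
    rw [Finset.mul_sum, Finset.mul_sum, Finset.sum_mul]
    refine Finset.sum_congr rfl fun j _ => ?_
    ring
  have hchar : ∫ k : ℕ, Complex.exp ((u * a * Real.exp (-x) : ℝ) * (k : ℝ) * Complex.I)
      ∂poissonMeasure (Real.exp x).toNNReal = Complex.exp (Real.exp x *
        (Complex.exp ((u * a * Real.exp (-x) : ℝ) * Complex.I) - 1)) := by
    have := charFun_map_cast_poissonMeasure (Real.exp x).toNNReal (u * a * Real.exp (-x))
    rw [charFun_apply_real, integral_map .of_discrete (by fun_prop)] at this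
    rw [this, Real.coe_toNNReal _ (Real.exp_nonneg x)]
  simp_rw [hfac]
  rw [integral_fintype_prod_eq_prod (f := fun _ (k : ℕ) => Complex.exp (-(u * a * Complex.I)) *
        Complex.exp ((u * a * Real.exp (-x) : ℝ) * (k : ℝ) * Complex.I)), Finset.prod_const,
    integral_const_mul, hchar, ← Complex.exp_add, ← Complex.exp_nat_mul, Finset.card_univ,
    Fintype.card_fin]
  congr 1
  -- The centering by 1 in each response becomes the linear term of the cumulant because e^x e^{-x}
  -- = 1.
  have hexp : (Real.exp x : ℂ) * Real.exp (-x) = 1 := by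
    rw [← Complex.ofReal_mul, ← Real.exp_add]; simp
  push_cast at hexp ⊢
  linear_combination (n * u * a * Complex.I : ℂ) * hexp

/-! ### Stochastic orders, characteristic functions and normalizations -/

section StochasticOrder

variable {Ω : ℕ → Type*} [∀ k, MeasurableSpace (Ω k)] {P : ∀ k, Measure (Ω k)}

lemma IsLittleOpOne.comp_tendsto {X : ∀ k, Ω k → ℝ} (h : IsLittleOpOne P X) {φ : ℕ → ℕ}
    (hφ : Tendsto φ atTop atTop) : IsLittleOpOne (fun k => P (φ k)) fun k => X (φ k) :=
  fun ε hε => (h ε hε).comp hφ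

lemma IsBigOpOne.comp_tendsto {X : ∀ k, Ω k → ℝ} (h : IsBigOpOne P X) {φ : ℕ → ℕ}
    (hφ : Tendsto φ atTop atTop) : IsBigOpOne (fun k => P (φ k)) fun k => X (φ k) := by
  intro ε hε
  obtain ⟨C, hC⟩ := h ε hε
  exact ⟨C, hφ.eventually hC⟩

/-- A vanishing deterministic sequence times an `O_p(1)` sequence is `o_p(1)`. -/
lemma IsBigOpOne.mul_isLittleOpOne {X : ∀ k, Ω k → ℝ} (h : IsBigOpOne P X) {δ : ℕ → ℝ}
    (hδ : Tendsto δ atTop (𝓝 0)) : IsLittleOpOne P fun k ω => δ k * X k ω := by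
  intro ε hε
  rw [ENNReal.tendsto_nhds_zero]
  intro η hη
  obtain ⟨C, hC⟩ := h η hη
  have h1 : ∀ᶠ k in atTop, |δ k| * (|C| + 1) < ε := by
    have : Tendsto (fun k => |δ k| * (|C| + 1)) atTop (𝓝 0) := by
      simpa using hδ.abs.mul_const (|C| + 1)
    exact this.eventually_lt_const hε
  filter_upwards [hC, h1] with k hk hk1
  refine (measure_mono fun ω hω => ?_).trans hk
  by_contra hlt
  have hlt : |X k ω| ≤ C := not_lt.1 hlt
  have hω : ε ≤ |δ k * X k ω| := hω
  rw [abs_mul] at hω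
  have : |δ k| * |X k ω| ≤ |δ k| * (|C| + 1) := by
    gcongr
    linarith [le_abs_self C]
  linarith

variable [∀ k, IsProbabilityMeasure (P k)]

/-- Pointwise convergence of the characteristic functions to a function that is continuous at `0`
implies stochastic boundedness. -/
lemma isBigOpOne_of_tendsto_charFun {X : ∀ k, Ω k → ℝ} (hX : ∀ k, AEMeasurable (X k) (P k))
    {f : ℝ → ℂ} (hf : ContinuousAt f 0)
    (h : ∀ t, Tendsto (fun k => charFun ((P k).map (X k)) t) atTop (𝓝 (f t))) :
    IsBigOpOne P X := by
  have hprob (k : ℕ) := Measure.isProbabilityMeasure_map (hX k)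
  have ht := tendsto_measure_norm_gt_of_isTightMeasureSet
    (isTightMeasureSet_of_tendsto_charFun hf h)
  intro ε hε
  obtain ⟨C, hC⟩ := (ENNReal.tendsto_nhds_zero.1 ht ε hε).exists
  refine ⟨C, .of_forall fun k => ?_⟩
  have h1 := (le_iSup₂ (f := fun μ (_ : μ ∈ Set.range fun k => (P k).map (X k)) =>
    μ {x : ℝ | C < ‖x‖}) _ ⟨k, rfl⟩).trans hC
  refine le_trans ?_ h1
  exact Measure.le_map_apply (hX k) {x : ℝ | C < ‖x‖}

/-- An `o_p(1)` perturbation does not change the limit of the characteristic functions. -/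
lemma IsLittleOpOne.tendsto_charFun_sub {X Y : ∀ k, Ω k → ℝ}
    (hX : ∀ k, AEMeasurable (X k) (P k)) (hY : ∀ k, AEMeasurable (Y k) (P k))
    (h : IsLittleOpOne P fun k ω => Y k ω - X k ω) (t : ℝ) :
    Tendsto (fun k => charFun ((P k).map (Y k)) t - charFun ((P k).map (X k)) t) atTop (𝓝 0) := by
  rw [Metric.tendsto_nhds]
  intro η hη
  -- This makes |t|δ < η/2, with the added 1 covering t = 0. The exceptional event, where the
  -- integrand is at most 2, costs less than 2 · η/4.
  set δ : ℝ := η / (2 * (|t| + 1)) with hδ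
  have hδ0 : 0 < δ := by positivity
  have hsmall : ∀ᶠ k in atTop, (P k).real {ω | δ ≤ |Y k ω - X k ω|} < η / 4 := by
    have := (ENNReal.tendsto_toReal ENNReal.zero_ne_top).comp (h δ hδ0)
    exact this.eventually_lt_const (by simpa using hη)
  filter_upwards [hsmall] with k hk
  rw [dist_zero_right]
  have hXk := hX k
  have hYk := hY k
  have hA : NullMeasurableSet {ω | δ ≤ |Y k ω - X k ω|} (P k) :=
    nullMeasurableSet_le aemeasurable_const (hYk.sub hXk).abs
  have hint (Z : Ω k → ℝ) (hZ : AEMeasurable Z (P k)) :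
      Integrable (fun ω => Complex.exp (t * Z ω * Complex.I)) (P k) := by
    refine (integrable_const (1 : ℝ)).mono' (by fun_prop) (.of_forall fun ω => ?_)
    rw [← Complex.ofReal_mul, Complex.norm_exp_ofReal_mul_I]
  rw [charFun_apply_real, charFun_apply_real, integral_map hYk (by fun_prop),
    integral_map hXk (by fun_prop), ← integral_sub (hint _ hYk) (hint _ hXk)]
  have hbound (ω : Ω k) : ‖Complex.exp (t * Y k ω * Complex.I) -
      Complex.exp (t * X k ω * Complex.I)‖ ≤
      |t| * δ + {ω | δ ≤ |Y k ω - X k ω|}.indicator (fun _ => (2 : ℝ)) ω := by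
    rw [← Complex.ofReal_mul, ← Complex.ofReal_mul]
    by_cases hω : δ ≤ |Y k ω - X k ω|
    · rw [Set.indicator_of_mem (by exact hω)]
      have := norm_sub_le (Complex.exp ((t * Y k ω : ℝ) * Complex.I))
        (Complex.exp ((t * X k ω : ℝ) * Complex.I))
      rw [Complex.norm_exp_ofReal_mul_I, Complex.norm_exp_ofReal_mul_I] at this
      have : 0 ≤ |t| * δ := by positivity
      linarith
    · rw [Set.indicator_of_notMem (by exact hω), add_zero]
      have h1 : Complex.exp ((t * Y k ω : ℝ) * Complex.I) -
          Complex.exp ((t * X k ω : ℝ) * Complex.I) = Complex.exp ((t * X k ω : ℝ) * Complex.I) *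
          (Complex.exp (Complex.I * (t * (Y k ω - X k ω) : ℝ)) - 1) := by
        rw [mul_sub, ← Complex.exp_add, mul_one]
        congr 2
        push_cast
        ring
      rw [h1, norm_mul, Complex.norm_exp_ofReal_mul_I, one_mul]
      refine (Real.norm_exp_I_mul_ofReal_sub_one_le).trans ?_
      rw [Real.norm_eq_abs, abs_mul]
      gcongr
      exact (not_le.1 hω).le
  calc _ ≤ ∫ ω, (|t| * δ + {ω | δ ≤ |Y k ω - X k ω|}.indicator (fun _ => (2 : ℝ)) ω) ∂P k :=
        norm_integral_le_of_norm_le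
          ((integrable_const _).add ((integrable_const _).indicator₀ hA)) (.of_forall hbound)
    _ = |t| * δ + 2 * (P k).real {ω | δ ≤ |Y k ω - X k ω|} := by
        rw [integral_add (integrable_const _) ((integrable_const _).indicator₀ hA),
          integral_indicator₀ hA]
        simp [mul_comm]
    _ < η := by
        have : |t| * δ < η / 2 := by
          rw [hδ, mul_div_assoc', div_lt_div_iff₀ (by positivity) (by norm_num)]
          nlinarith [abs_nonneg t]
        linarith

/-- A shift only contributes a unimodular factor, so passing to the modulus removes the centering,
about which nothing is known. -/
lemma norm_charFun_map_affine {Ω' : Type*} [MeasurableSpace Ω'] {Q : Measure Ω'}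
    {X : Ω' → ℝ} (hX : AEMeasurable X Q) (r c t : ℝ) :
    ‖charFun (Q.map fun ω => r * X ω + c) t‖ = ‖charFun (Q.map X) (r * t)‖ := by
  have h : (fun ω => r * X ω + c) = (· + c) ∘ fun ω => r * X ω := rfl
  rw [h, ← AEMeasurable.map_map_of_aemeasurable (by fun_prop) (by fun_prop),
    charFun_map_add_const, norm_mul, charFun_map_mul_comp hX]
  rw [Complex.norm_exp_ofReal_mul_I, mul_one]

/-- A sequence whose characteristic functions converge to a limit that is neither unimodular
nor of Gaussian modulus is not asymptotically normal under any normalization. -/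
lemma not_isAsymptoticallyNormal_of_tendsto_charFun {X : ∀ k, Ω k → ℝ}
    (hX : ∀ k, AEMeasurable (X k) (P k)) {f : ℝ → ℂ} (hf : ContinuousAt f 0)
    (h : ∀ t, Tendsto (fun k => charFun ((P k).map (X k)) t) atTop (𝓝 (f t)))
    (hne : ∃ a, ‖f a‖ ≠ 1) (hng : ∀ c : ℝ, 0 < c → ∃ u, ‖f u‖ ≠ Real.exp (-(c * u ^ 2))) :
    ¬ IsAsymptoticallyNormal P X := by
  rintro ⟨r, c, μ, w, hw, hlim⟩
  have hY : ∀ k, AEMeasurable (fun ω => r k * X k ω + c k) (P k) := hlim.forall_aemeasurable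
  have hXO := isBigOpOne_of_tendsto_charFun hX hf h
  have hφ (t : ℝ) : Tendsto (fun k => charFun ((P k).map fun ω => r k * X k ω + c k) t) atTop
      (𝓝 (charFun (gaussianReal μ w) t)) := by
    simpa using ProbabilityMeasure.tendsto_iff_tendsto_charFun.1 hlim.tendsto t
  have hgauss (t : ℝ) : ‖charFun (gaussianReal μ w) t‖ = Real.exp (-(w * t ^ 2 / 2)) := by
    rw [charFun_gaussianReal, Complex.norm_exp]
    congr 1
    simp [← Complex.ofReal_pow, ← Complex.ofReal_mul]
  have hw0 : (0 : ℝ) < w := by positivity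
  -- Either the scales have a convergent subsequence, or their absolute values tend to infinity.
  by_cases hfreq : ∃ M : ℝ, ∃ᶠ k in atTop, r k ∈ Metric.closedBall 0 M
  · obtain ⟨M, hM⟩ := hfreq
    obtain ⟨ρ, -, φ, hφmono, hρ⟩ := tendsto_subseq_of_frequently_bounded Metric.isBounded_closedBall hM
    have hφtop := hφmono.tendsto_atTop
    have hδ : Tendsto (fun k => r (φ k) - ρ) atTop (𝓝 0) := by
      simpa [Function.comp_def] using hρ.sub_const ρ
    -- Tightness of `X` allows the scale to be replaced by its limit ρ at the cost of o_p(1).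
    have hop : IsLittleOpOne (fun k => P (φ k))
        fun k ω => r (φ k) * X (φ k) ω - ρ * X (φ k) ω := by
      simpa only [sub_mul] using (hXO.comp_tendsto hφtop).mul_isLittleOpOne hδ
    have hnorm (t : ℝ) : ‖f (ρ * t)‖ = Real.exp (-(w * t ^ 2 / 2)) := by
      have h1 := hop.tendsto_charFun_sub (fun k => (hX (φ k)).const_mul ρ)
        (fun k => (hX (φ k)).const_mul (r (φ k))) t
      have h2 := h1.add ((h (ρ * t)).comp hφtop)
      simp only [charFun_map_mul_comp (hX _), Function.comp_def, sub_add_cancel, zero_add] at h2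
      have h3 := ((hφ t).comp hφtop).norm
      simp only [Function.comp_def, norm_charFun_map_affine (hX _), hgauss] at h3
      exact tendsto_nhds_unique h2.norm h3
    -- If ρ = 0, the Gaussian modulus would be constant, contradicting w ≠ 0. Otherwise f itself
    -- would have Gaussian modulus, with rate w / (2ρ²).
    by_cases hρ0 : ρ = 0
    · have h0 := hnorm 0
      have h1 := hnorm 1
      rw [hρ0] at h0 h1
      simp only [zero_mul] at h0 h1
      rw [h0] at h1
      have := Real.exp_injective h1
      norm_num at this
      exact hw this
    · obtain ⟨u, hu⟩ := hng (w / (2 * ρ ^ 2)) (by positivity)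
      apply hu
      have := hnorm (u / ρ)
      rw [mul_div_cancel₀ _ hρ0] at this
      rw [this]
      congr 2
      field_simp
  · push Not at hfreq
    have hinv : Tendsto (fun k => (r k)⁻¹) atTop (𝓝 0) := by
      refine tendsto_inv₀_cobounded.comp (tendsto_norm_atTop_iff_cobounded.1 ?_)
      refine tendsto_atTop.2 fun M => (hfreq M).mono fun k hk => ?_
      simpa using (not_le.1 fun hle => hk (by simpa using hle)).le
    obtain ⟨a, ha⟩ := hne
    apply ha
    -- The normalized sequence is tight, so dividing it by the diverging scale leaves something
    -- tending to 0 in probability. Up to a shift this is `X`, which forces |f| = 1.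
    have hYO := isBigOpOne_of_tendsto_charFun hY (by fun_prop) hφ
    have hop := hYO.mul_isLittleOpOne hinv
    have h1 := (IsLittleOpOne.tendsto_charFun_sub (P := P) (X := fun _ _ => 0)
      (Y := fun k ω => (r k)⁻¹ * (r k * X k ω + c k)) (fun k => aemeasurable_const)
      (fun k => (hY k).const_mul _) (by simpa using hop) a)
    have h2 : Tendsto (fun k => charFun ((P k).map fun ω => (r k)⁻¹ * (r k * X k ω + c k)) a)
        atTop (𝓝 1) := by
      have := h1.add_const 1
      simpa using this
    have hr0 : ∀ᶠ k in atTop, r k ≠ 0 := by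
      filter_upwards [hfreq 0] with k hk h0
      exact hk (by simp [h0])
    have h3 : Tendsto (fun k => ‖charFun ((P k).map (X k)) a‖) atTop (𝓝 1) := by
      refine (norm_one (α := ℂ) ▸ h2.norm).congr' ?_
      filter_upwards [hr0] with k hk
      rw [charFun_map_mul_comp (hY k), norm_charFun_map_affine (hX k), mul_inv_cancel_left₀ hk]
    exact tendsto_nhds_unique (h a).norm h3

end StochasticOrder

/-! ### The lognormal variance mixture -/

/-- The characteristic function of the normal variance mixture `exp (-b / 2) * Z` with independent
`b ∼ N(0, v)` and `Z ∼ N(0, 1)`. -/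
noncomputable def lognormalMixtureCharFun (v : ℝ≥0) (u : ℝ) : ℝ :=
  ∫ x, Real.exp (-(u ^ 2 * Real.exp (-x) / 2)) ∂gaussianReal 0 v

lemma integrable_lognormalMixture (v : ℝ≥0) (u : ℝ) :
    Integrable (fun x => Real.exp (-(u ^ 2 * Real.exp (-x) / 2))) (gaussianReal 0 v) := by
  refine (integrable_const (1 : ℝ)).mono' (by fun_prop) (.of_forall fun x => ?_)
  rw [Real.norm_eq_abs, Real.abs_exp, Real.exp_le_one_iff, neg_nonpos]
  positivity

lemma continuous_lognormalMixtureCharFun (v : ℝ≥0) : Continuous (lognormalMixtureCharFun v) := by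
  refine continuous_of_dominated (bound := fun _ => 1) (fun u => by fun_prop)
    (fun u => .of_forall fun x => ?_) (integrable_const _) (.of_forall fun x => by fun_prop)
  rw [Real.norm_eq_abs, Real.abs_exp, Real.exp_le_one_iff, neg_nonpos]
  positivity

lemma lognormalMixtureCharFun_nonneg (v : ℝ≥0) (u : ℝ) : 0 ≤ lognormalMixtureCharFun v u :=
  integral_nonneg fun _ => (Real.exp_pos _).le

lemma lognormalMixtureCharFun_one_lt (v : ℝ≥0) : lognormalMixtureCharFun v 1 < 1 := by
  have h : 0 < ∫ x, (1 - Real.exp (-(1 ^ 2 * Real.exp (-x) / 2))) ∂gaussianReal 0 v := by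
    have hpos (x : ℝ) : 0 < 1 - Real.exp (-(1 ^ 2 * Real.exp (-x) / 2)) := by
      rw [sub_pos, Real.exp_lt_one_iff, neg_lt_zero]
      positivity
    rw [integral_pos_iff_support_of_nonneg (fun x => (hpos x).le)
      ((integrable_const _).sub (integrable_lognormalMixture v 1))]
    have : Function.support (fun x : ℝ => 1 - Real.exp (-(1 ^ 2 * Real.exp (-x) / 2))) =
        Set.univ := Set.eq_univ_of_forall fun x => (hpos x).ne'
    rw [this, measure_univ]
    exact one_pos
  rw [integral_sub (integrable_const _) (integrable_lognormalMixture v 1)] at h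
  simpa [lognormalMixtureCharFun] using h

/-- The mixture charges arbitrarily small variances, so its characteristic function decays more
slowly than that of any nondegenerate Gaussian. -/
lemma exists_lognormalMixtureCharFun_ne {v : ℝ≥0} (hv : v ≠ 0) {c : ℝ} (hc : 0 < c) :
    ∃ u, lognormalMixtureCharFun v u ≠ Real.exp (-(c * u ^ 2)) := by
  by_contra! hall
  -- On `A` the variance e^{-x} is below c, so the integrand is at least exp(-c u²/2), which
  -- eventually dwarfs exp(-c u²). A nondegenerate Gaussian charges this half-line.
  set A : Set ℝ := Set.Ioi (-Real.log c) with hAdef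
  have hA : 0 < (gaussianReal 0 v).real A := by
    rw [measureReal_def, ENNReal.toReal_pos_iff]
    refine ⟨pos_iff_ne_zero.2 fun h0 => ?_, measure_lt_top _ _⟩
    have := gaussianReal_absolutelyContinuous' 0 hv h0
    simp [hAdef] at this
  have hlow (u : ℝ) : (gaussianReal 0 v).real A * Real.exp (-(c * u ^ 2 / 2)) ≤
      Real.exp (-(c * u ^ 2)) := by
    rw [← hall u, lognormalMixtureCharFun]
    calc _ = ∫ _ in A, Real.exp (-(c * u ^ 2 / 2)) ∂gaussianReal 0 v := by simp
      _ ≤ ∫ x in A, Real.exp (-(u ^ 2 * Real.exp (-x) / 2)) ∂gaussianReal 0 v := by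
        refine setIntegral_mono_on (integrable_const _)
          (integrable_lognormalMixture v u).integrableOn measurableSet_Ioi fun x hx => ?_
        have hxc : Real.exp (-x) ≤ c := by
          rw [← Real.le_log_iff_exp_le hc]
          have : -Real.log c < x := hx
          linarith
        rw [Real.exp_le_exp, neg_le_neg_iff, mul_comm c]
        gcongr
      _ ≤ _ := setIntegral_le_integral (integrable_lognormalMixture v u)
        (.of_forall fun x => (Real.exp_pos _).le)
  have hlow' (u : ℝ) : (gaussianReal 0 v).real A ≤ Real.exp (-(c * u ^ 2 / 2)) := by
    have := hlow u
    rw [show -(c * u ^ 2) = -(c * u ^ 2 / 2) + -(c * u ^ 2 / 2) by ring, Real.exp_add] at this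
    exact le_of_mul_le_mul_right this (Real.exp_pos _)
  have hlim : Tendsto (fun u : ℝ => Real.exp (-(c * u ^ 2 / 2))) atTop (𝓝 0) := by
    refine Real.tendsto_exp_neg_atTop_nhds_zero.comp ?_
    exact ((tendsto_pow_atTop two_ne_zero).const_mul_atTop hc).atTop_div_const two_pos
  exact absurd (ge_of_tendsto' hlim hlow') (not_le.2 hA)

/-! ### Convergence of the standardized sum -/

/-- With θ = u n^{-1/2} e^{-x}, the quadratic term -n e^x θ²/2 is exactly the limit, and the cubic
remainder is of order n · n^{-3/2}. -/
lemma tendsto_poisson_cumulant {n : ℕ → ℕ} (hn : Tendsto n atTop atTop) (u x : ℝ) :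
    Tendsto (fun k => (n k * Real.exp x *
      (Complex.exp ((u * (√(n k : ℝ))⁻¹ * Real.exp (-x) : ℝ) * Complex.I) - 1 -
        (u * (√(n k : ℝ))⁻¹ * Real.exp (-x) : ℝ) * Complex.I) : ℂ)) atTop
      (𝓝 (-(u ^ 2 * Real.exp (-x) / 2) : ℝ)) := by
  have ha : Tendsto (fun k => (√(n k : ℝ))⁻¹) atTop (𝓝 0) :=
    tendsto_inv_atTop_zero.comp
      (Real.tendsto_sqrt_atTop.comp (tendsto_natCast_atTop_atTop.comp hn))
  rw [tendsto_iff_norm_sub_tendsto_zero]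
  have hbd : Tendsto (fun k => |u| ^ 3 * Real.exp (-x) ^ 2 * (√(n k : ℝ))⁻¹ *
      Real.exp (|u| * (√(n k : ℝ))⁻¹ * Real.exp (-x))) atTop (𝓝 0) := by
    have h2 : Tendsto (fun k => Real.exp (|u| * (√(n k : ℝ))⁻¹ * Real.exp (-x))) atTop
        (𝓝 (Real.exp (|u| * 0 * Real.exp (-x)))) :=
      (Real.continuous_exp.tendsto _).comp ((ha.const_mul _).mul_const _)
    simpa using (ha.const_mul (|u| ^ 3 * Real.exp (-x) ^ 2)).mul h2
  refine squeeze_zero_norm' ?_ hbd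
  filter_upwards [hn.eventually_gt_atTop 0] with k hk
  have hk' : (0 : ℝ) < n k := by exact_mod_cast hk
  have hs0 : 0 < √(n k : ℝ) := Real.sqrt_pos.2 hk'
  set a : ℝ := (√(n k : ℝ))⁻¹ with hadef
  have ha0 : 0 < a := by positivity
  have hna : (n k : ℝ) * a ^ 2 = 1 := by
    rw [hadef, inv_pow, Real.sq_sqrt hk'.le, mul_inv_cancel₀ hk'.ne']
  have hee : Real.exp x * Real.exp (-x) = 1 := by rw [← Real.exp_add]; simp
  set θ : ℝ := u * a * Real.exp (-x) with hθ
  have hθn : ‖(θ : ℂ) * Complex.I‖ = |u| * a * Real.exp (-x) := by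
    rw [norm_mul, Complex.norm_I, mul_one, Complex.norm_real, Real.norm_eq_abs, hθ, abs_mul, abs_mul,
      abs_of_pos ha0, Real.abs_exp]
  have hquad : (n k : ℝ) * Real.exp x * (θ ^ 2 / 2) = u ^ 2 * Real.exp (-x) / 2 := by
    rw [hθ]
    linear_combination (u ^ 2 * Real.exp (-x) / 2) * (n k * a ^ 2) * hee +
      (u ^ 2 * Real.exp (-x) / 2) * hna
  have hmain := Complex.norm_exp_sub_sum_le_norm_mul_exp ((θ : ℂ) * Complex.I) 3
  have hsum : ∑ i ∈ Finset.range 3, ((θ : ℂ) * Complex.I) ^ i / (i.factorial : ℂ) =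
      1 + θ * Complex.I - (θ ^ 2 / 2 : ℝ) := by
    simp [Finset.sum_range_succ, Nat.factorial, mul_pow]
    ring
  rw [hsum, hθn] at hmain
  rw [norm_norm]
  have heq : (n k * Real.exp x * (Complex.exp (θ * Complex.I) - 1 - θ * Complex.I) : ℂ) -
      (-(u ^ 2 * Real.exp (-x) / 2) : ℝ) = (n k * Real.exp x : ℝ) *
        (Complex.exp (θ * Complex.I) - (1 + θ * Complex.I - (θ ^ 2 / 2 : ℝ))) := by
    rw [← hquad]
    push_cast
    ring
  rw [heq, norm_mul, Complex.norm_real, Real.norm_of_nonneg (by positivity)]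
  calc _ ≤ (n k * Real.exp x) * ((|u| * a * Real.exp (-x)) ^ 3 *
        Real.exp (|u| * a * Real.exp (-x))) := by gcongr
    _ = _ := by
      linear_combination |u| ^ 3 * Real.exp (-x) ^ 2 * a * Real.exp (|u| * a * Real.exp (-x)) *
        ((n k * a ^ 2) * hee + hna)

/-- The exponent has real part n e^x (cos θ - 1) ≤ 0. This gives the constant dominating function
for integrating over the random effect. -/
lemma norm_exp_poisson_cumulant_le_one (n : ℕ) (x θ : ℝ) :
    ‖Complex.exp (n * Real.exp x * (Complex.exp (θ * Complex.I) - 1 - θ * Complex.I))‖ ≤ 1 := by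
  rw [Complex.norm_exp, Real.exp_le_one_iff]
  have h : (n * Real.exp x * (Complex.exp (θ * Complex.I) - 1 - θ * Complex.I) : ℂ) =
      (n * Real.exp x : ℝ) * (Complex.exp (θ * Complex.I) - 1 - θ * Complex.I) := by
    push_cast; ring
  rw [h, Complex.re_ofReal_mul, Complex.sub_re, Complex.sub_re, Complex.exp_ofReal_mul_I_re]
  simp only [Complex.one_re, Complex.re_ofReal_mul, Complex.I_re, mul_zero, sub_zero]
  exact mul_nonpos_of_nonneg_of_nonpos (by positivity) (by linarith [Real.cos_le_one θ])

/-- The standardized response sum of a cluster converges to the lognormal variance mixture. -/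
lemma tendsto_charFun_standardizedSum {Ω : ℕ → Type*} [∀ k, MeasurableSpace (Ω k)]
    {P : ∀ k, Measure (Ω k)} [∀ k, IsProbabilityMeasure (P k)] {m n : ℕ → ℕ}
    (hn : Tendsto n atTop atTop) {v : ℝ≥0}
    {b : ∀ k, Fin (m k) → Ω k → ℝ} {y : ∀ k, Fin (m k) → Fin (n k) → Ω k → ℕ}
    (hmodel : ∀ k, PoissonRandomIntercept (P k) (m k) (n k) v (b k) (y k))
    (i : ∀ k, Fin (m k)) (u : ℝ) :
    Tendsto (fun k => charFun ((P k).map fun ω => (√(n k : ℝ))⁻¹ *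
      ∑ j, ((y k (i k) j ω : ℝ) * Real.exp (-(b k (i k) ω)) - 1)) u) atTop
      (𝓝 (lognormalMixtureCharFun v u : ℂ)) := by
  simp_rw [fun k => (hmodel k).charFun_map_sum (i k)]
  rw [lognormalMixtureCharFun, ← integral_complex_ofReal]
  refine tendsto_integral_of_dominated_convergence (fun _ => 1) (fun k => by fun_prop)
    (integrable_const _) (fun k => .of_forall fun x => norm_exp_poisson_cumulant_le_one _ _ _)
    (.of_forall fun x => ?_)
  refine (Complex.ofReal_exp (-(u ^ 2 * Real.exp (-x) / 2))).symm ▸ (Complex.continuous_exp.tendsto _).comp (tendsto_poisson_cumulant hn u x)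

/-! ### The estimating equation and its linearization -/

lemma log_poissonLogLinkDensity (η : ℝ) (y : ℕ) :
    Real.log (poissonLogLinkDensity η y) = y * η - Real.exp η - Real.log y.factorial := by
  rw [poissonLogLinkDensity, Real.log_div (Real.exp_pos _).ne' (by positivity), Real.log_exp]

/-- The estimating equation solved by each coordinate of a PQL estimate. -/
lemma IsPQLEstimate.score_eq_zero {m n : ℕ} {y : Fin m → Fin n → ℕ} {s : ℝ} {β : Fin m → ℝ}
    (h : IsPQLEstimate y s β) (i : Fin m) :
    ∑ j, ((y i j : ℝ) - Real.exp (β i)) - s⁻¹ * β i = 0 := by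
  -- The objective is a sum of one-variable functions, so varying a single coordinate shows that
  -- each one is maximized separately.
  let q : Fin m → ℝ → ℝ := fun i t =>
    ∑ j, Real.log (poissonLogLinkDensity t (y i j)) - (1 / 2) * (t * s⁻¹ * t)
  have hQ (β : Fin m → ℝ) : pqlObjective y s β = ∑ i, q i (β i) := by
    simp only [pqlObjective, q, Finset.sum_sub_distrib, Finset.mul_sum]
  have hmax : IsLocalMax (q i) (β i) := by
    refine .of_forall fun t => ?_
    have h1 : pqlObjective y s (Function.update β i t) ≤ pqlObjective y s β :=
      h (Set.mem_univ _)
    rw [hQ, hQ, ← Finset.add_sum_erase _ _ (Finset.mem_univ i),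
      ← Finset.add_sum_erase _ (fun i => q i (β i)) (Finset.mem_univ i),
      Function.update_self] at h1
    have h2 : ∑ x ∈ Finset.univ.erase i, q x (Function.update β i t x) =
        ∑ x ∈ Finset.univ.erase i, q x (β x) :=
      Finset.sum_congr rfl fun x hx => by rw [Function.update_of_ne (Finset.ne_of_mem_erase hx)]
    rw [h2] at h1
    exact le_of_add_le_add_right h1
  have hderiv : HasDerivAt (q i) (∑ j, ((y i j : ℝ) - Real.exp (β i)) - s⁻¹ * β i) (β i) := by
    have h1 : HasDerivAt (fun t => ∑ j, Real.log (poissonLogLinkDensity t (y i j)))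
        (∑ j, ((y i j : ℝ) - Real.exp (β i))) (β i) := by
      simp_rw [log_poissonLogLinkDensity]
      refine HasDerivAt.fun_sum fun j _ => ?_
      simpa using (((hasDerivAt_id (β i)).const_mul (y i j : ℝ)).sub
        (Real.hasDerivAt_exp (β i))).sub_const (Real.log (y i j).factorial)
    have h2 : HasDerivAt (fun t : ℝ => (1 / 2) * (t * s⁻¹ * t)) (s⁻¹ * β i) (β i) := by
      refine ((((hasDerivAt_id (β i)).mul_const s⁻¹).mul (hasDerivAt_id (β i))).const_mul
        (1 / 2 : ℝ)).congr_deriv ?_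
      simp only [id]
      ring
    exact h1.sub h2
  exact hmax.hasDerivAt_eq_zero hderiv

/-- A solution `Δ` of a monotone perturbation of `exp Δ - 1 = r` is of the order of `r`. -/
lemma abs_le_two_mul_of_exp_sub_one {Δ t r : ℝ} (ht : 0 ≤ t)
    (h : |Real.exp Δ - 1 + t * Δ| ≤ r) (hr : r ≤ 1 / 2) : |Δ| ≤ 2 * r := by
  have hexp := Real.add_one_le_exp Δ
  obtain ⟨h1, h2⟩ := abs_le.1 h
  rcases le_total 0 Δ with hΔ | hΔ
  · rw [abs_of_nonneg hΔ]
    nlinarith [mul_nonneg ht hΔ]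
  · rw [abs_of_nonpos hΔ]
    -- For negative Δ, invert this bound: 1/(1 - r) ≤ 1 + 2r holds because 0 ≤ r ≤ 1/2, and this is
    -- where the factor 2 arises.
    have h3 : 1 - r ≤ Real.exp Δ := by nlinarith [mul_nonneg ht (neg_nonneg.2 hΔ)]
    have h4 := Real.add_one_le_exp (-Δ)
    have h5 : Real.exp Δ * Real.exp (-Δ) = 1 := by rw [← Real.exp_add]; simp
    have h6 : Real.exp (-Δ) ≤ 1 + 2 * r := by
      have := Real.exp_pos (-Δ)
      nlinarith
    linarith

/-- Deterministic linearization of the estimating equation. -/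
lemma abs_sqrt_mul_sub_le {N B S τ Δ C : ℝ} (hN : 0 < N) (hB : |B| ≤ C) (hS : |S| ≤ C)
    (hτ0 : 0 ≤ τ) (hτ : τ ≤ C) (hN1 : 1 ≤ N)
    (heq : N * Real.exp B * (Real.exp Δ - 1) + τ * (B + Δ) = √N * Real.exp B * S)
    (hK : (C + C ^ 2 * Real.exp C) / √N ≤ 1 / 2) :
    |√N * Δ - S| ≤ (4 * (C + C ^ 2 * Real.exp C) ^ 2 + C * (C + 1) * Real.exp C) / √N := by
  have hC : 0 ≤ C := (abs_nonneg _).trans hB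
  -- The summand C bounds the contribution of S, and C² e^C that of the penalty at B.
  set K := C + C ^ 2 * Real.exp C with hKdef
  have hs : 0 < √N := Real.sqrt_pos.2 hN
  have hs1 : 1 ≤ √N := Real.one_le_sqrt.2 hN1
  have hss : √N * √N = N := Real.mul_self_sqrt hN.le
  have hee : Real.exp B * Real.exp (-B) = 1 := by rw [← Real.exp_add]; simp
  have heB : Real.exp (-B) ≤ Real.exp C := Real.exp_le_exp.2 (by linarith [(abs_le.1 hB).1])
  have hlin : N * (Real.exp Δ - 1) + τ * (B + Δ) * Real.exp (-B) = √N * S := by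
    linear_combination Real.exp (-B) * heq + (√N * S - N * (Real.exp Δ - 1)) * hee
  have heq' : Real.exp Δ - 1 + τ * Real.exp (-B) / N * Δ =
      S / √N - τ * B * Real.exp (-B) / N := by
    have hSN : S / √N = √N * S / N := by
      rw [div_eq_div_iff hs.ne' hN.ne']
      linear_combination -S * hss
    rw [hSN, ← hlin]
    field_simp
    ring
  have hr : |Real.exp Δ - 1 + τ * Real.exp (-B) / N * Δ| ≤ K / √N := by
    rw [heq']
    have h1 : |S / √N| ≤ C / √N := by
      rw [abs_div, abs_of_pos hs]
      gcongr
    have h2 : |τ * B * Real.exp (-B) / N| ≤ C ^ 2 * Real.exp C / √N := by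
      rw [abs_div, abs_mul, abs_mul, abs_of_nonneg hτ0, Real.abs_exp, abs_of_pos hN, sq]
      have : √N ≤ N := by nlinarith
      gcongr
    calc _ ≤ |S / √N| + |τ * B * Real.exp (-B) / N| := abs_sub _ _
      _ ≤ _ := by rw [hKdef, add_div]; gcongr
  have hΔ := abs_le_two_mul_of_exp_sub_one (by positivity) hr hK
  have hΔ1 : |Δ| ≤ 1 := by linarith
  have hquad := Real.abs_exp_sub_one_sub_id_le hΔ1
  -- The error is the quadratic remainder of the exponential, controlled by √N Δ² with |Δ| ≤ 2K/√N,
  -- plus the penalty term divided by √N.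
  have hid : √N * Δ - S = -(√N * (Real.exp Δ - 1 - Δ)) - τ * (B + Δ) * Real.exp (-B) / √N := by
    rw [show τ * (B + Δ) * Real.exp (-B) = √N * S - √N * √N * (Real.exp Δ - 1) by
      rw [hss]; linarith]
    field_simp
    ring
  have h1 : |√N * (Real.exp Δ - 1 - Δ)| ≤ 4 * K ^ 2 / √N := by
    rw [abs_mul, abs_of_pos hs]
    have h2 : Δ ^ 2 ≤ (2 * (K / √N)) ^ 2 := by
      rw [← sq_abs]
      gcongr
    calc _ ≤ √N * (2 * (K / √N)) ^ 2 := by gcongr; exact hquad.trans h2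
      _ = _ := by field_simp; ring
  have h2 : |τ * (B + Δ) * Real.exp (-B) / √N| ≤ C * (C + 1) * Real.exp C / √N := by
    rw [abs_div, abs_mul, abs_mul, abs_of_nonneg hτ0, Real.abs_exp, abs_of_pos hs]
    have : |B + Δ| ≤ C + 1 := (abs_add_le _ _).trans (add_le_add hB hΔ1)
    gcongr
  rw [hid]
  calc _ ≤ |-(√N * (Real.exp Δ - 1 - Δ))| + |τ * (B + Δ) * Real.exp (-B) / √N| := abs_sub _ _
    _ ≤ _ := by rw [abs_neg, add_div]; gcongr

/-! ### Expansion of the gap and failure of asymptotic normality -/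

theorem mainTheorem7
    (Ω : ℕ → Type*) [∀ k, MeasurableSpace (Ω k)]
    (P : ∀ k, Measure (Ω k)) [∀ k, IsProbabilityMeasure (P k)]
    -- numbers of clusters and common cluster sizes
    (m n : ℕ → ℕ) (hm_pos : ∀ k, 0 < m k)
    (hm : Tendsto m atTop atTop) (hn : Tendsto n atTop atTop)
    (hmn : Tendsto (fun k => (m k : ℝ) / (n k : ℝ) ^ 2) atTop (𝓝 0))
    -- the data: true random effects and responses
    (v : ℝ≥0) (hv : 0 < v)
    (b : ∀ k, Fin (m k) → Ω k → ℝ) (y : ∀ k, Fin (m k) → Fin (n k) → Ω k → ℕ)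
    (hmodel : ∀ k, PoissonRandomIntercept (P k) (m k) (n k) v (b k) (y k))
    -- the working variance, possibly stochastic, with stochastically bounded inverse
    (s : ∀ k, Ω k → ℝ) (hs_meas : ∀ k, AEMeasurable (s k) (P k))
    (hs_pos : ∀ k, ∀ᵐ ω ∂(P k), 0 < s k ω)
    (hs_bdd : IsBigOpOne P (fun k ω => (s k ω)⁻¹))
    -- the PQL estimator of the random effects
    (bhat : ∀ k, Ω k → Fin (m k) → ℝ) (hbhat_meas : ∀ k, AEMeasurable (bhat k) (P k))
    (hbhat : ∀ k, ∀ᵐ ω ∂(P k), IsPQLEstimate (fun i j => y k i j ω) (s k ω) (bhat k ω)) :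
    -- the first cluster
    let i₁ : ∀ k, Fin (m k) := fun k => ⟨0, hm_pos k⟩
    -- the prediction gap of the first cluster
    let gap : ∀ k, Ω k → ℝ := fun k ω => bhat k ω (i₁ k) - b k (i₁ k) ω
    -- the leading term `n^{-1/2} ∑ j, (y_{1j} exp(-b_1) - 1)`
    let S : ∀ k, Ω k → ℝ := fun k ω =>
      (√(n k : ℝ))⁻¹ * ∑ j, ((y k (i₁ k) j ω : ℝ) * Real.exp (-(b k (i₁ k) ω)) - 1)
    IsLittleOpOne P (fun k ω => √(n k : ℝ) * gap k ω - S k ω) ∧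
      ¬ IsAsymptoticallyNormal P S ∧
      ¬ IsAsymptoticallyNormal P gap := by
  intro i₁ gap S
  have hb (k : ℕ) : Measurable (b k (i₁ k)) := (hmodel k).measurable_effect _
  have hSm (k : ℕ) : Measurable (S k) := by
    have := (hmodel k).measurable_response (i₁ k)
    have := hb k
    fun_prop
  have hgapm (k : ℕ) : AEMeasurable (gap k) (P k) :=
    (aemeasurable_pi_iff.1 (hbhat_meas k) (i₁ k)).sub (hb k).aemeasurable
  have hSchar := tendsto_charFun_standardizedSum hn hmodel i₁
  have hcont : Continuous fun u => (lognormalMixtureCharFun v u : ℂ) :=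
    Complex.continuous_ofReal.comp (continuous_lognormalMixtureCharFun v)
  have hSO : IsBigOpOne P S :=
    isBigOpOne_of_tendsto_charFun (fun k => (hSm k).aemeasurable) hcont.continuousAt hSchar
  have hBO : IsBigOpOne P fun k ω => b k (i₁ k) ω := by
    refine isBigOpOne_of_tendsto_charFun (f := charFun (gaussianReal 0 v))
      (fun k => (hb k).aemeasurable) (by fun_prop) fun t => ?_
    simp_rw [fun k => ((hmodel k).law_effect (i₁ k)).map_eq]
    exact tendsto_const_nhds
  have hsqrt : Tendsto (fun k => √(n k : ℝ)) atTop atTop :=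
    Real.tendsto_sqrt_atTop.comp (tendsto_natCast_atTop_atTop.comp hn)
  have hop : IsLittleOpOne P fun k ω => √(n k : ℝ) * gap k ω - S k ω := by
    intro ε hε
    rw [ENNReal.tendsto_nhds_zero]
    intro η hη
    have hη3 : 0 < η / 3 := ENNReal.div_pos hη.ne' (by norm_num)
    obtain ⟨C₁, hC₁⟩ := hSO _ hη3
    obtain ⟨C₂, hC₂⟩ := hBO _ hη3
    obtain ⟨C₃, hC₃⟩ := hs_bdd _ hη3
    -- Off three events of probability at most η/3 each, one constant bounds S, the effect and the
    -- inverse working variance. The linearization is then deterministic there, with error below ε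
    -- for large k.
    set C := max C₁ (max C₂ C₃)
    have hdiv (c : ℝ) : Tendsto (fun k => c / √(n k : ℝ)) atTop (𝓝 0) :=
      hsqrt.const_div_atTop c
    filter_upwards [hC₁, hC₂, hC₃, hn.eventually_ge_atTop 1,
      (hdiv (C + C ^ 2 * Real.exp C)).eventually_le_const (by norm_num : (0 : ℝ) < 1 / 2),
      (hdiv (4 * (C + C ^ 2 * Real.exp C) ^ 2 + C * (C + 1) * Real.exp C)).eventually_lt_const hε]
      with k h1 h2 h3 hnk hK hKε
    have hsub : ∀ᵐ ω ∂P k, ω ∈ {ω | ε ≤ |√(n k : ℝ) * gap k ω - S k ω|} →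
        ω ∈ {ω | C₁ < |S k ω|} ∪ {ω | C₂ < |b k (i₁ k) ω|} ∪ {ω | C₃ < |(s k ω)⁻¹|} := by
      filter_upwards [hs_pos k, hbhat k] with ω hpos hest hω
      by_contra hnot
      simp only [Set.mem_union, Set.mem_ofPred_eq, not_or, not_lt] at hnot hω
      obtain ⟨⟨hS, hB⟩, hτ⟩ := hnot
      have hnk1 : (1 : ℝ) ≤ n k := by exact_mod_cast hnk
      have hnk0 : (0 : ℝ) < n k := by linarith
      have hscore := hest.score_eq_zero (i₁ k)
      have hSdef : √(n k : ℝ) * S k ω =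
          ∑ j, ((y k (i₁ k) j ω : ℝ) * Real.exp (-(b k (i₁ k) ω)) - 1) :=
        mul_inv_cancel_left₀ (Real.sqrt_pos.2 hnk0).ne' _
      have hbd := abs_sqrt_mul_sub_le (C := C) (Δ := gap k ω) hnk0 (hB.trans (by simp [C]))
        (hS.trans (by simp [C])) (inv_nonneg.2 hpos.le)
        ((le_abs_self _).trans (hτ.trans (by simp [C]))) hnk1 ?_ hK
      · linarith
      · have hee : Real.exp (b k (i₁ k) ω) * Real.exp (-(b k (i₁ k) ω)) = 1 := by
          rw [← Real.exp_add]; simp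
        have hgap : b k (i₁ k) ω + gap k ω = bhat k ω (i₁ k) := by simp [gap]
        have hexp : Real.exp (b k (i₁ k) ω) * Real.exp (gap k ω) = Real.exp (bhat k ω (i₁ k)) := by
          rw [← Real.exp_add, hgap]
        rw [Finset.sum_sub_distrib, ← Finset.sum_mul] at hSdef
        rw [Finset.sum_sub_distrib] at hscore
        simp only [Finset.sum_const, Finset.card_univ, Fintype.card_fin, nsmul_eq_mul] at hSdef hscore
        rw [hgap]
        linear_combination (n k : ℝ) * hexp - Real.exp (b k (i₁ k) ω) * hSdef - hscore -
          (∑ j, (y k (i₁ k) j ω : ℝ)) * hee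
    calc _ ≤ P k ({ω | C₁ < |S k ω|} ∪ {ω | C₂ < |b k (i₁ k) ω|} ∪ {ω | C₃ < |(s k ω)⁻¹|}) :=
          measure_mono_ae hsub
      _ ≤ η / 3 + η / 3 + η / 3 :=
          (measure_union_le _ _).trans (add_le_add ((measure_union_le _ _).trans
            (add_le_add h1 h2)) h3)
      _ = η := ENNReal.add_thirds η
  have hne : ∃ a, ‖(lognormalMixtureCharFun v a : ℂ)‖ ≠ 1 := by
    refine ⟨1, ?_⟩
    rw [Complex.norm_real, Real.norm_of_nonneg (lognormalMixtureCharFun_nonneg v 1)]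
    exact (lognormalMixtureCharFun_one_lt v).ne
  have hng (c : ℝ) (hc : 0 < c) :
      ∃ u, ‖(lognormalMixtureCharFun v u : ℂ)‖ ≠ Real.exp (-(c * u ^ 2)) := by
    obtain ⟨u, hu⟩ := exists_lognormalMixtureCharFun_ne hv.ne' hc
    refine ⟨u, ?_⟩
    rwa [Complex.norm_real, Real.norm_of_nonneg (lognormalMixtureCharFun_nonneg v u)]
  refine ⟨hop, not_isAsymptoticallyNormal_of_tendsto_charFun (fun k => (hSm k).aemeasurable)
    hcont.continuousAt hSchar hne hng, ?_⟩
  -- This scale is eventually √n but never vanishes, even if n k = 0. Any normalization r of the gap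
  -- thus becomes r / d for the rescaled gap.
  set d : ℕ → ℝ := fun k => max 1 √(n k : ℝ) with hd
  have hd0 (k : ℕ) : d k ≠ 0 := (one_pos.trans_le (le_max_left _ _)).ne'
  have hdn : ∀ᶠ k in atTop, d k = √(n k : ℝ) :=
    (hsqrt.eventually_ge_atTop 1).mono fun k hk => max_eq_right hk
  have hgchar (t : ℝ) : Tendsto (fun k => charFun ((P k).map fun ω => d k * gap k ω) t)
      atTop (𝓝 (lognormalMixtureCharFun v t : ℂ)) := by
    have := (hop.tendsto_charFun_sub (fun k => (hSm k).aemeasurable)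
      (fun k => (hgapm k).const_mul _) t).add (hSchar t)
    rw [zero_add] at this
    refine this.congr' (hdn.mono fun k hk => ?_)
    simp only [hk, S, sub_add_cancel]
  rintro ⟨r, c, μ, w, hw, hlim⟩
  refine not_isAsymptoticallyNormal_of_tendsto_charFun (fun k => (hgapm k).const_mul (d k))
    hcont.continuousAt hgchar hne hng ⟨fun k => r k / d k, c, μ, w, hw, ?_⟩
  simpa only [← mul_assoc, div_mul_cancel₀ _ (hd0 _)] using hlim
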